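/- Let $\Lambda,r,N$ be integers with $1\le r\le\Lambda$ and $N\ge K:=\binom{\Lambda}{r}$, and let $M_a,M_p\ge 0$ be real numbers with $M_a+M_p<N$. In the $(\Lambda,r,M_a,M_p,N)$-CMAP coded caching system, a server holds $N$ files of $B$ bits each; there are $\Lambda$ access caches, each able to store $M_a$ files ($M_aB$ bits), and $K$ users, one for each $r$-subset $\mathcal U$ of the access caches. User $\mathcal U$ reads the $r$ access caches in $\mathcal U$ and also has a private cache able to store $M_p$ files. In a scheme with uncoded placement, every cache stores some set of bits of the library, subject to its memory constraint and chosen before the demands are known. Afterwards every user demands one of the $N$ files; given the vector $\mathbf d$ of all demands, the server broadcasts a string of bits computed from the library, and every user must recover the demanded file, without error and for every content of the library, from the broadcast, the bits in the user's caches and $\mathbf d$. The triplet $(M_a,M_p,R)$ is achievable if for all sufficiently large $B$ there is such a scheme that broadcasts at most $RB$ bits for every demand vector, and $R^*_{UC}(M_a,M_p)$ is the infimum of all $R$ such that $(M_a,M_p,R)$ is achievable. Then $$R^*_D(rM_a+M_p)\;\le\;R^*_{UC}(M_a,M_p)\;\le\;R^*_{CMACC}\!\left(M_a+\tfrac{M_p}{r}\right),$$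 both when the broadcast may be an arbitrary function of the library and when every broadcast bit has to be an XOR of bits of the library. Here $R^*_D(M)$ is the rate of the Maddah-Ali–Niesen (MAN) scheme for $N$ files and $K$ users with dedicated caches of $M$ files: $R^*_D(M)=\binom{K}{t+1}/\binom{K}{t}$ if $t=KM/N$ is an integer in $[0,K]$, and $R^*_D(M)=R^*_D(N)=0$ if $M>N$. Similarly, $R^*_{CMACC}(M)$ is the rate of the MAN scheme for the combinatorial multi-access network with $\Lambda$ caches of $M\le N$ files, one user for each $r$-subset of the caches, and no private caches: $R^*_{CMACC}(M)=\binom{\Lambda}{t+r}/\binom{\Lambda}{t}$ if $t=\Lambda M/N$ is an integer in $[0,\Lambda]$. If $t$ is not an integer, both rates are those obtained by memory sharing, that is, by linear interpolation in $t$ between the values at $\lfloor t\rfloor$ and $\lceil t\rceil$. ($\binom nk=0$ for $k>n$.) -/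

import Mathlib

namespace CMAP

/-- A user of the system with `Λ` access caches and access degree `r`: the `r`-subset of the
access caches that the user is connected to. -/
abbrev User (Λ r : ℕ) : Type := {U : Finset (Fin Λ) // U.card = r}

/-- A library of `N` files of `B` bits each. Bits are elements of `ZMod 2`, so that XOR is `+`. -/
abbrev Library (N B : ℕ) : Type := Fin N → Fin B → ZMod 2

/-- A demand vector: every user asks for one of the `N` files (repetitions are allowed). -/
abbrev Demand (Λ r N : ℕ) : Type := User Λ r → Fin N

/-- An uncoded placement of a library of `N` files of `B` bits: every access cache and every
private cache stores an (arbitrary) set of bits of the library, a bit being addressed by its file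
and its position in that file. -/
structure Placement (Λ r N B : ℕ) where
  /-- content of an access cache -/
  access : Fin Λ → Finset (Fin N × Fin B)
  /-- content of the private cache of a user -/
  priv : User Λ r → Finset (Fin N × Fin B)

/-- All the bits available to a user: those in the access caches the user is connected to, and
those in the user's private cache. -/
def Placement.available {Λ r N B : ℕ} (P : Placement Λ r N B) (U : User Λ r) :
    Finset (Fin N × Fin B) :=
  U.1.biUnion P.access ∪ P.priv U

/-- An access cache stores at most `Ma` files and a private cache at most `Mp` files. -/
def Placement.FitsMemory {Λ r N B : ℕ} (P : Placement Λ r N B) (Ma Mp : ℝ) : Prop :=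
  (∀ a, ((P.access a).card : ℝ) ≤ Ma * B) ∧ (∀ U, ((P.priv U).card : ℝ) ≤ Mp * B)

/-- A coded caching scheme with uncoded placement. The placement does not depend on the demand.
For each demand `d` the server broadcasts `length d` bits, computed from the library; every user
recovers the demanded file, without error and for every library, from the available bits and the
broadcast (the demand vector is known to everyone). -/
structure Scheme (Λ r N B : ℕ) where
  placement : Placement Λ r N B
  length : Demand Λ r N → ℕ
  encode : (d : Demand Λ r N) → Library N B → (Fin (length d) → ZMod 2)
  decode : (d : Demand Λ r N) → (U : User Λ r) → (placement.available U → ZMod 2) →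
    (Fin (length d) → ZMod 2) → (Fin B → ZMod 2)
  decode_encode : ∀ d U (W : Library N B),
    decode d U (fun p => W p.1.1 p.1.2) (encode d W) = W (d U)

/-- Which delivery policies the server may use: arbitrary functions of the library, or only
transmissions that are XORs of pieces of the library. -/
inductive Delivery
  | arbitrary
  | xor

/-- The delivery policy of a scheme is of the given kind. -/
def Scheme.Uses {Λ r N B : ℕ} (S : Scheme Λ r N B) : Delivery → Prop
  | .arbitrary => True
  | .xor => ∀ d (j : Fin (S.length d)), ∃ A : Finset (Fin N × Fin B),
      ∀ W, S.encode d W j = ∑ p ∈ A, W p.1 p.2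

/-- The triplet `(Ma, Mp, R)` is achievable with uncoded placement: for every large enough file
size `B` there is a scheme that respects the memory constraints and that broadcasts, for every
(hence for the worst) demand vector, at most `R` files, that is `R * B` bits. -/
def Achievable (δ : Delivery) (Λ r N : ℕ) (Ma Mp R : ℝ) : Prop :=
  ∀ᶠ B : ℕ in Filter.atTop, ∃ S : Scheme Λ r N B,
    S.Uses δ ∧ S.placement.FitsMemory Ma Mp ∧ ∀ d, (S.length d : ℝ) ≤ R * B

/-- The optimal worst-case rate under uncoded placement. -/
noncomputable def optimalRate (δ : Delivery) (Λ r N : ℕ) (Ma Mp : ℝ) : ℝ :=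
  sInf {R : ℝ | Achievable δ Λ r N Ma Mp R}

/-- Memory sharing: a rate `f t`, given for integer values of the replication factor `t`, is
extended to real `t ≥ 0` by splitting every file in a part of relative size `α` served with
`⌈t⌉` and a part of relative size `1 - α` served with `⌊t⌋`, where
`t = α * ⌈t⌉ + (1 - α) * ⌊t⌋`. -/
noncomputable def memorySharing (f : ℕ → ℝ) (t : ℝ) : ℝ :=
  Int.fract t * f ⌈t⌉₊ + (1 - Int.fract t) * f ⌊t⌋₊

/-- The rate of the Maddah-Ali--Niesen scheme for `N` files and `K` users with dedicated caches of
`M` files: with `t = K * M / N` an integer, every file is divided into `K.choose t` subfiles and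
there is one transmission of that size for each `(t + 1)`-subset of the users. A cache
of more than `N` files is used as a cache of `N` files. -/
noncomputable def manRate (K N : ℕ) (M : ℝ) : ℝ :=
  memorySharing (fun t => (K.choose (t + 1) : ℝ) / (K.choose t : ℝ)) (K * min M N / N)

/-- The rate of the Maddah-Ali--Niesen scheme for the combinatorial multi-access network with `N`
files, `Λ` caches of `M ≤ N` files, and one user for each `r`-subset of the caches: with
`t = Λ * M / N` an integer, every file is divided into `Λ.choose t` subfiles and there is one
transmission of that size for each `(t + r)`-subset of the caches. -/
noncomputable def cmaccRate (Λ r N : ℕ) (M : ℝ) : ℝ :=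
  memorySharing (fun t => (Λ.choose (t + r) : ℝ) / (Λ.choose t : ℝ)) (Λ * M / N)

end CMAP

/-!
*Lower bound.* Fix a scheme with uncoded placement, an order of the users, and a demand vector with
distinct files. A genie argument shows that the broadcast determines every bit of a demanded file
that neither its user nor an earlier user can read: set all other bits of the library to zero and
let the users decode in order, each one needing only bits decoded before. So the broadcast has at
least as many bits (`Scheme.acyclic_bound`). Averaging over the cyclic shifts of one demand
vector makes every bit of the library count equally often, and averaging over the orders makes a bit
that `t` of the `K` users can read contribute `(K - t) / (t + 1)`, the expected number of users that
precede those `t` users (`sum_orders_card_precede`). This function of `t` is the rate of the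
Maddah-Ali--Niesen scheme. It is convex and decreasing, and the average of `t` over the library is at
most `K * (r * Ma + Mp) / N`, because a user can read at most `(r * Ma + Mp) * B` bits; comparing with
a chord (`chord_le`) gives the bound (`Scheme.manRate_le`).

*Upper bound.* Take the multi-access scheme for caches of `Ma + Mp / r` files, and split the content
of each cache in a part of `Ma` files, which stays in the access cache, and a part of `Mp / r` files.
The private cache of a user holds the second parts of the `r` caches the user is connected to. Then
every user sees the same bits as in the multi-access network, and the same XORs serve all demands
(`exists_scheme_of_labels`). Since the file size need not be divisible by the binomial coefficients,
subfile sizes are rounded down and a bounded number of bits is left uncached. Such bits are sent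
separately to every user, which costs nothing in the limit (`exists_scheme_of_mixture`).
-/

namespace CMAP

/-! ### Memory sharing -/

/-- In the definition of memory sharing `⌈t⌉` can be replaced by `⌊t⌋ + 1`: they differ only for
integers `t`, where that term has weight zero. -/
theorem memorySharing_eq (f : ℕ → ℝ) {t : ℝ} (ht : 0 ≤ t) :
    memorySharing f t = Int.fract t * f (⌊t⌋₊ + 1) + (1 - Int.fract t) * f ⌊t⌋₊ := by
  unfold memorySharing
  rcases eq_or_ne (Int.fract t) 0 with h | h
  · simp [h]
  · have hlt : (⌊t⌋₊ : ℝ) < t := by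
      refine lt_of_le_of_ne (Nat.floor_le ht) fun he => h ?_
      rw [← he, Int.fract_natCast]
    have : ⌈t⌉₊ = ⌊t⌋₊ + 1 :=
      le_antisymm (Nat.ceil_le_floor_add_one t) (Nat.lt_ceil.2 hlt)
    rw [this]

theorem fract_eq_sub_natFloor {t : ℝ} (ht : 0 ≤ t) : Int.fract t = t - ⌊t⌋₊ := by
  rw [Int.fract, natCast_floor_eq_intCast_floor ht]

theorem choose_succ_div_choose {K t : ℕ} (h : t ≤ K) :
    (K.choose (t + 1) : ℝ) / K.choose t = (K - t) / (t + 1) := by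
  have h0 : (0 : ℝ) < K.choose t := by exact_mod_cast Nat.choose_pos h
  have h1 : (K.choose (t + 1) : ℝ) * (t + 1) = K.choose t * (K - t) := by
    have := Nat.choose_succ_right_eq K t
    rw [← Nat.cast_sub h]
    exact_mod_cast this
  rw [div_eq_div_iff h0.ne' (by positivity), h1]
  ring

/-- The chord of the convex function `x ↦ (K - x) / (x + 1)` through the consecutive integers `m`
and `m + 1` lies below it at all integers. -/
theorem chord_le (K : ℝ) (hK : 0 ≤ K) (m t : ℕ) :
    (K - m) / (m + 1) + (t - m) * (-(K + 1) / ((m + 1) * (m + 2))) ≤ (K - t) / (t + 1) := by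
  have hint : (0 : ℝ) ≤ ((t : ℝ) - m) * (t - m - 1) := by
    have : (0 : ℤ) ≤ ((t : ℤ) - m) * (t - m - 1) := by
      rcases le_or_gt (t : ℤ) m with h | h
      · exact mul_nonneg_of_nonpos_of_nonpos (by omega) (by omega)
      · exact mul_nonneg (by omega) (by omega)
    exact_mod_cast this
  have key : (K - t) / (t + 1) -
      ((K - m) / (m + 1) + (t - m) * (-(K + 1) / ((m + 1) * (m + 2)))) =
      (K + 1) * (((t : ℝ) - m) * (t - m - 1)) / ((t + 1) * (m + 1) * (m + 2)) := by
    field_simp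
    ring
  rw [← sub_nonneg, key]
  positivity

/-! ### Random orders of the users -/

open Finset in
/-- In a uniformly random order, `u` precedes all elements of `A` with probability
`1 / (#A + 1)`: each element of `insert u A` is equally likely to come first. -/
theorem card_orders_precede {ι : Type*} [Fintype ι] [DecidableEq ι] {A : Finset ι} {u : ι}
    (hu : u ∉ A) :
    (#A + 1) * #{σ : ι ≃ Fin (Fintype.card ι) | ∀ v ∈ A, σ u < σ v} =
      (Fintype.card ι).factorial := by
  set E : ι → Finset (ι ≃ Fin (Fintype.card ι)) :=
    fun w => {σ | ∀ v ∈ insert u A, σ w ≤ σ v} with hE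
  have hEu : ({σ : ι ≃ Fin (Fintype.card ι) | ∀ v ∈ A, σ u < σ v} : Finset _) = E u := by
    ext σ
    simp only [hE, mem_filter, mem_univ, true_and, mem_insert, forall_eq_or_imp, le_refl]
    refine forall₂_congr fun v hv => ⟨le_of_lt, fun h => lt_of_le_of_ne h fun h' => ?_⟩
    exact hu (σ.injective h' ▸ hv)
  have hswap : ∀ w ∈ insert u A, #(E w) = #(E u) := by
    intro w hw
    have hmem : ∀ v ∈ insert u A, Equiv.swap u w v ∈ insert u A := by
      intro v hv
      by_cases h1 : v = u
      · simpa [h1] using hw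
      by_cases h2 : v = w
      · simp [h2]
      · rwa [Equiv.swap_apply_of_ne_of_ne h1 h2]
    refine card_nbij' (fun σ => (Equiv.swap u w).trans σ) (fun σ => (Equiv.swap u w).trans σ)
      ?_ ?_ ?_ ?_
    · intro σ hσ
      simp only [hE, coe_filter, mem_univ, true_and, Set.mem_ofPred_eq, Equiv.trans_apply,
        Equiv.swap_apply_left] at hσ ⊢
      exact fun v hv => hσ _ (hmem v hv)
    · intro σ hσ
      simp only [hE, coe_filter, mem_univ, true_and, Set.mem_ofPred_eq, Equiv.trans_apply,
        Equiv.swap_apply_right] at hσ ⊢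
      exact fun v hv => hσ _ (hmem v hv)
    · intro σ _; ext; simp
    · intro σ _; ext; simp
  have hone : ∀ σ : ι ≃ Fin (Fintype.card ι),
      #{w ∈ insert u A | ∀ v ∈ insert u A, σ w ≤ σ v} = 1 := by
    intro σ
    obtain ⟨w, hw, hmin⟩ := exists_min_image (insert u A) σ ⟨u, mem_insert_self _ _⟩
    refine card_eq_one.2 ⟨w, ?_⟩
    ext x
    simp only [mem_filter, mem_singleton]
    constructor
    · rintro ⟨hx, h⟩
      exact σ.injective (le_antisymm (h w hw) (hmin x hx))
    · rintro rfl
      exact ⟨hw, hmin⟩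
  have hsum : ∑ w ∈ insert u A, #(E w) = (Fintype.card ι).factorial := by
    have h1 : ∑ w ∈ insert u A, #(E w) =
        ∑ σ : ι ≃ Fin (Fintype.card ι),
          #{w ∈ insert u A | ∀ v ∈ insert u A, σ w ≤ σ v} := by
      simp only [hE, card_filter]
      rw [sum_comm]
    rw [h1, sum_congr rfl fun σ _ => hone σ]
    simp [Fintype.card_equiv (Fintype.equivFin ι)]
  rw [hEu, ← hsum, sum_congr rfl hswap, sum_const, card_insert_of_notMem hu, smul_eq_mul]

open Finset in
/-- The expected number of elements that precede all of `A` in a uniformly random order. -/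
theorem sum_orders_card_precede {ι : Type*} [Fintype ι] [DecidableEq ι] (A : Finset ι) :
    ∑ σ : ι ≃ Fin (Fintype.card ι), (#{u : ι | ∀ v ∈ A, σ u < σ v} : ℝ) =
      (Fintype.card ι).factorial * ((Fintype.card ι - #A) / (#A + 1)) := by
  have h1 : ∑ σ : ι ≃ Fin (Fintype.card ι), (#{u : ι | ∀ v ∈ A, σ u < σ v} : ℝ) =
      ∑ u : ι, (#{σ : ι ≃ Fin (Fintype.card ι) | ∀ v ∈ A, σ u < σ v} : ℝ) := by
    simp only [card_filter, Nat.cast_sum]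
    rw [sum_comm]
  have h2 : ∀ u : ι, (#{σ : ι ≃ Fin (Fintype.card ι) | ∀ v ∈ A, σ u < σ v} : ℝ) =
      if u ∈ Aᶜ then ((Fintype.card ι).factorial : ℝ) / (#A + 1) else 0 := by
    intro u
    split_ifs with hu
    · rw [eq_div_iff (by positivity), mul_comm]
      exact_mod_cast card_orders_precede (mem_compl.1 hu)
    · have hu' : u ∈ A := by simpa using hu
      rw [Nat.cast_eq_zero, card_eq_zero, filter_eq_empty_iff]
      exact fun σ _ h => lt_irrefl _ (h u hu')
  rw [h1, sum_congr rfl fun u _ => h2 u, sum_ite_mem, univ_inter, sum_const, card_compl,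
    nsmul_eq_mul, Nat.cast_sub (card_le_univ A)]
  ring

/-! ### The converse bound -/

variable {Λ r N B : ℕ}

open Finset in
/-- The users that can read a given bit of the library. -/
def Placement.holders (P : Placement Λ r N B) (p : Fin N × Fin B) : Finset (User Λ r) :=
  {U | p ∈ P.available U}

open Finset in
/-- The acyclic index coding bound: if the users demand distinct files, then the server has to send
as many bits as there are bits `b` of the file demanded by some user `U` which neither `U` nor any
user preceding `U` in the order `σ` can read. -/
theorem Scheme.acyclic_bound (S : Scheme Λ r N B) {d : Demand Λ r N} (hd : d.Injective)
    (σ : User Λ r ≃ Fin (Fintype.card (User Λ r))) :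
    ∑ U, #{b : Fin B | ∀ V ∈ S.placement.holders (d U, b), σ U < σ V} ≤ S.length d := by
  classical
  set E : Finset (Σ _ : User Λ r, Fin B) :=
    univ.sigma fun U => {b : Fin B | ∀ V ∈ S.placement.holders (d U, b), σ U < σ V} with hE
  set D : Finset (Fin N × Fin B) := E.image fun x => (d x.1, x.2) with hD
  have hcard : #D = ∑ U, #{b : Fin B | ∀ V ∈ S.placement.holders (d U, b), σ U < σ V} := by
    rw [hD, card_image_of_injective, hE, card_sigma]
    rintro ⟨U, b⟩ ⟨U', b'⟩ h
    simp only [Prod.mk.injEq] at h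
    obtain ⟨h1, rfl⟩ := h
    rw [hd h1]
  have hDmem : ∀ U b, (d U, b) ∈ D → ∀ V, (d U, b) ∈ S.placement.available V → σ U < σ V := by
    intro U b h V hV
    simp only [hD, hE, mem_image, mem_sigma, mem_univ, true_and, mem_filter, Prod.mk.injEq,
      Sigma.exists] at h
    obtain ⟨U', b', h1, h2, rfl⟩ := h
    obtain rfl := hd h2
    exact h1 V (by simpa [Placement.holders] using hV)
  -- The libraries that vanish outside of `D` are determined by the broadcast.
  let lib : (D → ZMod 2) → Library N B :=
    fun w n b => if h : (n, b) ∈ D then w ⟨(n, b), h⟩ else 0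
  have hlib : ∀ w (p : D), lib w p.1.1 p.1.2 = w p := by
    intro w p
    simp [lib]
  have hlib0 : ∀ w n b, (n, b) ∉ D → lib w n b = 0 := by
    intro w n b h
    simp [lib, h]
  have hinj : Function.Injective fun w => S.encode d (lib w) := by
    intro w w' hw
    have hdec : ∀ m : ℕ, ∀ U, (σ U : ℕ) = m → lib w (d U) = lib w' (d U) := by
      intro m
      induction m using Nat.strong_induction_on with
      | _ m ih =>
        intro U hU
        rw [← S.decode_encode d U (lib w), ← S.decode_encode d U (lib w')]
        congr 1
        funext ⟨⟨n, b⟩, hp⟩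
        by_cases h : (n, b) ∈ D
        · obtain ⟨x, -, hx⟩ := mem_image.1 h
          simp only [Prod.mk.injEq] at hx
          obtain ⟨rfl, rfl⟩ := hx
          have hlt := hDmem _ _ h U hp
          exact congrFun (ih _ (hU ▸ hlt) _ rfl) _
        · simp only [hlib0 _ _ _ h]
    funext p
    obtain ⟨x, -, hx⟩ := mem_image.1 p.2
    rw [← hlib w, ← hlib w', ← hx]
    exact congrFun (hdec _ x.1 rfl) _
  have := Fintype.card_le_of_injective _ hinj
  simp only [Fintype.card_fun, ZMod.card, Fintype.card_coe, Fintype.card_fin] at this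
  rw [← hcard]
  exact (Nat.pow_le_pow_iff_right (by norm_num)).1 this

open Finset in
/-- Averaging the acyclic bound: over the cyclic shifts of an injective demand vector, so that
every user demands every file equally often, and over all orders of the users. -/
theorem Scheme.sum_holders_le (S : Scheme Λ r N B) {R : ℝ} (hN : Fintype.card (User Λ r) ≤ N)
    (hS : ∀ d, (S.length d : ℝ) ≤ R * B) :
    ∑ p, ((Fintype.card (User Λ r) - #(S.placement.holders p) : ℝ) /
      (#(S.placement.holders p) + 1)) ≤ N * (R * B) := by
  rcases Nat.eq_zero_or_pos N with rfl | hpos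
  · simp
  have : NeZero N := ⟨hpos.ne'⟩
  -- The demand vectors are `c + e U` for `c : Fin N`, with addition modulo `N`.
  let e : User Λ r ↪ Fin N := (Fintype.equivFin _).toEmbedding.trans (Fin.castLEEmb hN)
  have hσ : ∀ σ : User Λ r ≃ Fin (Fintype.card (User Λ r)),
      ∑ p, (#{U | ∀ V ∈ S.placement.holders p, σ U < σ V} : ℝ) ≤ N * (R * B) := by
    intro σ
    have h1 : ∀ c : Fin N, ((∑ U, #{b : Fin B | ∀ V ∈ S.placement.holders (c + e U, b),
        σ U < σ V} : ℕ) : ℝ) ≤ R * B := fun c =>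
      le_trans (Nat.cast_le.2 (S.acyclic_bound (d := fun U => c + e U)
        (fun U V h => e.injective (add_left_cancel h)) σ)) (hS _)
    have h2 := sum_le_sum fun c (_ : c ∈ univ) => h1 c
    rw [sum_const, card_univ, Fintype.card_fin, nsmul_eq_mul] at h2
    refine le_trans (le_of_eq ?_) h2
    have h3 : ∀ U : User Λ r, ∑ c : Fin N,
        #{b : Fin B | ∀ V ∈ S.placement.holders (c + e U, b), σ U < σ V} =
        ∑ n : Fin N, #{b : Fin B | ∀ V ∈ S.placement.holders (n, b), σ U < σ V} := fun U =>
      Equiv.sum_comp (Equiv.addRight (e U))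
        fun n => #{b : Fin B | ∀ V ∈ S.placement.holders (n, b), σ U < σ V}
    rw [← Nat.cast_sum, ← Nat.cast_sum, sum_comm, sum_congr rfl fun U _ => h3 U]
    simp only [card_filter]
    rw [sum_comm]
    exact congrArg _ (sum_congr rfl fun U _ => Fintype.sum_prod_type _)
  have hfact : (0 : ℝ) < (Fintype.card (User Λ r)).factorial := by
    exact_mod_cast Nat.factorial_pos _
  have h := sum_le_sum fun σ (_ : σ ∈ univ) => hσ σ
  rw [sum_comm, sum_congr rfl fun p _ => sum_orders_card_precede (S.placement.holders p),
    ← mul_sum, sum_const, card_univ, Fintype.card_equiv (Fintype.equivFin _), nsmul_eq_mul] at h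
  exact le_of_mul_le_mul_left h hfact

open Finset in
/-- The memory constraints bound the total number of pairs of a bit and a user who can read it. -/
theorem Placement.sum_card_holders_le (P : Placement Λ r N B) {Ma Mp : ℝ}
    (hP : P.FitsMemory Ma Mp) :
    ∑ p, (#(P.holders p) : ℝ) ≤ Fintype.card (User Λ r) * ((r * Ma + Mp) * B) := by
  have h1 : ∑ p, (#(P.holders p) : ℝ) = ∑ U, (#(P.available U) : ℝ) := by
    simp only [Placement.holders, card_filter, Nat.cast_sum]
    rw [sum_comm]
    simp
  have h2 : ∀ U, (#(P.available U) : ℝ) ≤ (r * Ma + Mp) * B := by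
    intro U
    have h3 : #(P.available U) ≤ ∑ a ∈ U.1, #(P.access a) + #(P.priv U) :=
      (card_union_le _ _).trans (Nat.add_le_add_right card_biUnion_le _)
    have h4 : ∑ a ∈ U.1, (#(P.access a) : ℝ) ≤ r * (Ma * B) := by
      refine (sum_le_sum fun a _ => hP.1 a).trans (le_of_eq ?_)
      rw [sum_const, U.2, nsmul_eq_mul]
    have h5 : (#(P.available U) : ℝ) ≤ ∑ a ∈ U.1, (#(P.access a) : ℝ) + #(P.priv U) := by
      exact_mod_cast h3
    linarith [hP.2 U]
  rw [h1]
  refine (sum_le_sum fun U _ => h2 U).trans (le_of_eq ?_)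
  rw [sum_const, card_univ, nsmul_eq_mul]

open Finset in
/-- The converse for one file size: by convexity the averaged acyclic bound is smallest when all bits
of the library can be read by about the same number of users. -/
theorem Scheme.manRate_le (S : Scheme Λ r N B) {Ma Mp R : ℝ} (hB : 0 < B) (hrΛ : r ≤ Λ)
    (hN : Λ.choose r ≤ N) (hMa : 0 ≤ Ma) (hMp : 0 ≤ Mp) (hP : S.placement.FitsMemory Ma Mp)
    (hS : ∀ d, (S.length d : ℝ) ≤ R * B) :
    manRate (Λ.choose r) N (r * Ma + Mp) ≤ R := by
  have hK : Fintype.card (User Λ r) = Λ.choose r := by simp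
  set K := Λ.choose r with hKdef
  have hKpos : 0 < K := Nat.choose_pos hrΛ
  have hNpos : (0 : ℝ) < N := by exact_mod_cast hKpos.trans_le hN
  have hKpos' : (0 : ℝ) < K := by exact_mod_cast hKpos
  have hBpos : (0 : ℝ) < B := by exact_mod_cast hB
  set M : ℝ := r * Ma + Mp with hM
  have hM0 : 0 ≤ M := by positivity
  have hR : 0 ≤ R := by
    have d : Demand Λ r N := fun _ => ⟨0, hKpos.trans_le hN⟩
    exact nonneg_of_mul_nonneg_left ((Nat.cast_nonneg _).trans (hS d)) hBpos
  unfold manRate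
  set t : ℝ := K * min M N / N with ht
  have ht0 : 0 ≤ t := by positivity
  rw [memorySharing_eq _ ht0]
  have hfr := fract_eq_sub_natFloor ht0
  set m := ⌊t⌋₊ with hm
  rcases le_or_gt (N : ℝ) M with hNM | hMN
  · -- Every user can store the whole library: the rate of the dedicated network is zero.
    have htK : t = K := by
      rw [ht, min_eq_right hNM]
      field_simp
    have hmK : m = K := by rw [hm, htK, Nat.floor_natCast]
    have : Int.fract t = 0 := by rw [hfr, hmK, htK, sub_self]
    rw [this, hmK]
    simpa using hR
  · have htK : t = K * M / N := by rw [ht, min_eq_left hMN.le]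
    have htlt : t < K := by
      rw [htK, div_lt_iff₀ hNpos]
      exact mul_lt_mul_of_pos_left hMN hKpos'
    have hmK : m < K := (Nat.floor_lt ht0).2 htlt
    rw [choose_succ_div_choose hmK.le, choose_succ_div_choose (by omega : m + 1 ≤ K), hfr]
    set c : ℝ := -(K + 1) / ((m + 1) * (m + 2)) with hc
    have hc0 : c ≤ 0 := by
      rw [hc]
      exact div_nonpos_of_nonpos_of_nonneg (by linarith) (by positivity)
    have hval : (t - m) * (((K : ℝ) - (m + 1 : ℕ)) / ((m + 1 : ℕ) + 1)) +
        (1 - (t - m)) * ((K - m) / (m + 1)) = (K - m) / (m + 1) + (t - m) * c := by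
      rw [hc]
      push_cast
      field_simp
      ring
    rw [hval]
    have h1 := S.sum_holders_le (hK ▸ hN) hS
    have h2 := S.placement.sum_card_holders_le hP
    rw [hK] at h1 h2
    have h3 : ∑ p, ((K - m : ℝ) / (m + 1) + (#(S.placement.holders p) - m) * c) ≤
        N * (R * B) :=
      (sum_le_sum fun p _ => chord_le K hKpos'.le m #(S.placement.holders p)).trans h1
    rw [sum_add_distrib, ← sum_mul, sum_sub_distrib] at h3
    simp only [sum_const, card_univ, Fintype.card_prod, Fintype.card_fin, nsmul_eq_mul,
      Nat.cast_mul] at h3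
    have h4 : (K * (M * B)) * c ≤ (∑ p, (#(S.placement.holders p) : ℝ)) * c :=
      mul_le_mul_of_nonpos_right h2 hc0
    have h5 : (K : ℝ) * (M * B) = t * (N * B) := by
      rw [htK]
      field_simp
    have hNB : (0 : ℝ) < N * B := by positivity
    refine le_of_mul_le_mul_left ?_ hNB
    rw [h5] at h4
    nlinarith [h3, h4]

/-! ### The multi-access scheme -/

open Classical in
/-- The scheme with a given placement and given XORs as transmissions; it exists as soon as what is
available to a user together with the broadcast determines the demanded file. -/
noncomputable def Scheme.ofXor (P : Placement Λ r N B) (ℓ : ℕ)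
    (A : Demand Λ r N → Fin ℓ → Finset (Fin N × Fin B))
    (h : ∀ d U (W W' : Library N B), (∀ p ∈ P.available U, W p.1 p.2 = W' p.1 p.2) →
      (∀ j, ∑ p ∈ A d j, W p.1 p.2 = ∑ p ∈ A d j, W' p.1 p.2) → W (d U) = W' (d U)) :
    Scheme Λ r N B where
  placement := P
  length _ := ℓ
  encode d W j := ∑ p ∈ A d j, W p.1 p.2
  decode d U z x :=
    if hW : ∃ W : Library N B, (fun p : P.available U => W p.1.1 p.1.2) = z ∧
      (fun j => ∑ p ∈ A d j, W p.1 p.2) = x then hW.choose (d U) else 0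
  decode_encode d U W := by
    have hW : ∃ W' : Library N B, (fun p : P.available U => W' p.1.1 p.1.2) =
        (fun p : P.available U => W p.1.1 p.1.2) ∧
        (fun j => ∑ p ∈ A d j, W' p.1 p.2) = fun j => ∑ p ∈ A d j, W p.1 p.2 := ⟨W, rfl, rfl⟩
    rw [dif_pos hW]
    exact h d U _ _ (fun p hp => congrFun hW.choose_spec.1 ⟨p, hp⟩)
      fun j => congrFun hW.choose_spec.2 j

open Finset in
/-- The labels `(T, j)` of the bits of a file: for every set `T` of caches there are `s #T` bits that are
stored exactly in the caches in `T`. -/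
def labels (Λ : ℕ) (s : ℕ → ℕ) : Finset (Σ _ : Finset (Fin Λ), ℕ) :=
  univ.sigma fun T => range (s #T)

open Finset in
/-- The transmissions: for every set `S` of at least `r` caches there are as many as there are bits
with a given label set of `#S - r` caches. -/
def transmissions (Λ r : ℕ) (s : ℕ → ℕ) : Finset (Σ _ : Finset (Fin Λ), ℕ) :=
  (univ.filter fun S => r ≤ #S).sigma fun S => range (s (#S - r))

open Finset in
/-- The bits of the library stored in cache `a` when bit `b` of every file has label `e b`. -/
def stored (N : ℕ) {s : ℕ → ℕ} (e : Fin B ≃ labels Λ s) (a : Fin Λ) : Finset (Fin N × Fin B) :=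
  {p | a ∈ (e p.2).1.1}

open Finset in
/-- The delivery of the multi-access Maddah-Ali--Niesen scheme. The transmission with index `(S, j)`
is the XOR, over the users `U ⊆ S`, of the `j`-th bit of the file demanded by `U` with label set
`S \ U`. All users `U' ≠ U` in this sum involve a bit which is stored in a cache of `U`. -/
theorem exists_scheme_of_labels {s : ℕ → ℕ} (e : Fin B ≃ labels Λ s) (P : Placement Λ r N B)
    (hP : ∀ U : User Λ r, ∀ a ∈ U.1, stored N e a ⊆ P.available U) :
    ∃ S : Scheme Λ r N B, S.placement = P ∧ S.Uses .xor ∧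
      ∀ d, S.length d = #(transmissions Λ r s) := by
  let f := (transmissions Λ r s).equivFin
  let X : Demand Λ r N → (Σ _ : Finset (Fin Λ), ℕ) → Finset (Fin N × Fin B) := fun d i =>
    {p | ∃ U : User Λ r, U.1 ⊆ i.1 ∧ d U = p.1 ∧ (e p.2).1 = ⟨i.1 \ U.1, i.2⟩}
  refine ⟨Scheme.ofXor P _ (fun d j => X d (f.symm j).1) ?_, rfl, fun d j => ⟨_, fun W => rfl⟩,
    fun d => rfl⟩
  intro d U W W' hav hx
  funext b
  by_cases hdis : ∃ a ∈ U.1, a ∈ (e b).1.1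
  · obtain ⟨a, haU, ha⟩ := hdis
    exact hav (d U, b) (hP U a haU (by simpa [stored] using ha))
  · have hdisj : Disjoint (e b).1.1 U.1 :=
      disjoint_left.2 fun a h1 h2 => hdis ⟨a, h2, h1⟩
    have hT := mem_sigma.1 (show (e b).1 ∈ univ.sigma fun T => range (s #T) from (e b).2)
    have hi : (⟨(e b).1.1 ∪ U.1, (e b).1.2⟩ : Σ _ : Finset (Fin Λ), ℕ) ∈
        transmissions Λ r s := by
      rw [transmissions, mem_sigma]
      have hc : #((e b).1.1 ∪ U.1) = #(e b).1.1 + r := by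
        rw [card_union_of_disjoint hdisj, U.2]
      refine ⟨by simp [hc], ?_⟩
      simpa [hc] using hT.2
    have hsum := hx (f ⟨_, hi⟩)
    rw [Equiv.symm_apply_apply] at hsum
    have hmem : (d U, b) ∈ X d ⟨(e b).1.1 ∪ U.1, (e b).1.2⟩ := by
      simp only [X, mem_filter, mem_univ, true_and]
      exact ⟨U, subset_union_right, rfl, by rw [union_sdiff_cancel_right hdisj]⟩
    rw [← add_sum_erase _ _ hmem, ← add_sum_erase _ _ hmem] at hsum
    -- All other terms of the transmission are bits that `U` can read.
    have hrest : ∀ p ∈ (X d ⟨(e b).1.1 ∪ U.1, (e b).1.2⟩).erase (d U, b),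
        W p.1 p.2 = W' p.1 p.2 := by
      rintro ⟨n, b'⟩ hp
      obtain ⟨hne, hp⟩ := mem_erase.1 hp
      simp only [X, mem_filter, mem_univ, true_and] at hp
      obtain ⟨U', -, hn, hlab⟩ := hp
      have hUU : U' ≠ U := by
        rintro rfl
        rw [union_sdiff_cancel_right hdisj] at hlab
        exact hne (by rw [← hn, e.injective (Subtype.ext hlab)])
      obtain ⟨a, haU, haU'⟩ : ∃ a ∈ U.1, a ∉ U'.1 := by
        by_contra! hcon
        exact hUU (Subtype.ext (eq_of_subset_of_card_le hcon (by rw [U.2, U'.2])).symm)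
      refine hav (n, b') (hP U a haU ?_)
      simp only [stored, mem_filter, mem_univ, true_and, hlab]
      exact mem_sdiff.2 ⟨mem_union_right _ haU, haU'⟩
    rw [sum_congr rfl hrest] at hsum
    exact add_right_cancel hsum

open Finset in
/-- Splitting the content of an access cache of the multi-access network in a part that stays in the
access cache and a part for the private caches. The slack of one bit absorbs the rounding. -/
theorem exists_split {α : Type*} [DecidableEq α] (Z : Finset α) {x y : ℝ} (hx : 0 ≤ x)
    (hy : 0 ≤ y) (h : #Z = 0 ∨ (#Z : ℝ) + 1 ≤ x + y) :
    ∃ X Y, X ∪ Y = Z ∧ (#X : ℝ) ≤ x ∧ (#Y : ℝ) ≤ y := by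
  rcases h with h | h
  · exact ⟨∅, ∅, by simp [card_eq_zero.1 h], by simpa, by simpa⟩
  · rcases le_total #Z ⌊x⌋₊ with h1 | h1
    · exact ⟨Z, ∅, by simp, (Nat.le_floor_iff hx).1 h1, by simpa⟩
    · obtain ⟨X, hXZ, hX⟩ := exists_subset_card_eq h1
      refine ⟨X, Z \ X, union_sdiff_of_subset hXZ, hX ▸ Nat.floor_le hx, ?_⟩
      rw [card_sdiff_of_subset hXZ, Nat.cast_sub (card_le_card hXZ), hX]
      linarith [Nat.lt_floor_add_one x]

open Finset in
/-- The cache contents of the multi-access network, with access caches of `Ma + Mp / r` files, also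
serve the system with private caches: a private cache holds the second parts of the contents of the
`r` caches the user is connected to. -/
theorem exists_scheme_of_card_stored {s : ℕ → ℕ} (e : Fin B ≃ labels Λ s) {Ma Mp : ℝ} (hr : 1 ≤ r)
    (hMa : 0 ≤ Ma) (hMp : 0 ≤ Mp)
    (h : ∀ a, #(stored N e a) = 0 ∨ (#(stored N e a) : ℝ) + 1 ≤ (Ma + Mp / r) * B) :
    ∃ S : Scheme Λ r N B, S.Uses .xor ∧ S.placement.FitsMemory Ma Mp ∧
      ∀ d, S.length d = #(transmissions Λ r s) := by
  have hr0 : (0 : ℝ) < r := by exact_mod_cast hr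
  have hsplit : ∀ a, ∃ X Y, X ∪ Y = stored N e a ∧ (#X : ℝ) ≤ Ma * B ∧
      (#Y : ℝ) ≤ Mp / r * B := fun a =>
    exists_split _ (by positivity) (by positivity) (by simpa only [add_mul] using h a)
  choose X Y hXY hX hY using hsplit
  let P : Placement Λ r N B := ⟨X, fun U => U.1.biUnion Y⟩
  obtain ⟨S, hSP, hS, hlen⟩ := exists_scheme_of_labels e P (by
    intro U a ha
    rw [← hXY a]
    exact union_subset_union (subset_biUnion_of_mem X ha) (subset_biUnion_of_mem Y ha))
  refine ⟨S, hS, hSP ▸ ⟨hX, fun U => ?_⟩, hlen⟩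
  have h1 : (#(U.1.biUnion Y) : ℝ) ≤ ∑ a ∈ U.1, (#(Y a) : ℝ) := by
    exact_mod_cast card_biUnion_le
  refine h1.trans ((sum_le_sum fun a _ => hY a).trans (le_of_eq ?_))
  rw [sum_const, U.2, nsmul_eq_mul]
  field_simp

/-! ### Counting bits and transmissions -/

/-- The number of bits for each label set when every file has `x` bits for each set of `m + 1`
caches, `y` bits for each set of `m` caches and `z` bits that are not stored at all. -/
def mixture (m x y z k : ℕ) : ℕ :=
  (if k = m + 1 then x else 0) + (if k = m then y else 0) + (if k = 0 then z else 0)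

open Finset in
theorem card_filter_card_eq (Λ k : ℕ) : #{T : Finset (Fin Λ) | #T = k} = Λ.choose k := by
  simp

open Finset in
theorem sum_mixture {α : Type*} (F : Finset α) (g : α → ℕ) (m x y z : ℕ) :
    ∑ T ∈ F, mixture m x y z (g T) =
      x * #{T ∈ F | g T = m + 1} + y * #{T ∈ F | g T = m} + z * #{T ∈ F | g T = 0} := by
  simp only [mixture, sum_add_distrib, ← sum_filter, sum_const, smul_eq_mul]
  ring

open Finset in
theorem card_labels (Λ m x y z : ℕ) : #(labels Λ (mixture m x y z)) =
    x * Λ.choose (m + 1) + y * Λ.choose m + z := by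
  simp only [labels, card_sigma, card_range, sum_mixture, card_filter_card_eq]
  simp

open Finset in
theorem card_transmissions (Λ r m x y z : ℕ) : #(transmissions Λ r (mixture m x y z)) =
    x * Λ.choose (m + 1 + r) + y * Λ.choose (m + r) + z * Λ.choose r := by
  have h : ∀ k, #{S ∈ univ.filter (fun S : Finset (Fin Λ) => r ≤ #S) | #S - r = k} =
      Λ.choose (k + r) := by
    intro k
    rw [filter_filter, ← card_filter_card_eq]
    congr 1
    ext S
    simp only [mem_filter, mem_univ, true_and]
    omega
  simp only [transmissions, card_sigma, card_range, sum_mixture, h, zero_add]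

open Finset in
/-- Double counting: each cache belongs to a fraction `k / Λ` of the sets of `k` caches. -/
theorem mul_card_filter_mem (a : Fin Λ) (k : ℕ) :
    Λ * #{T : Finset (Fin Λ) | a ∈ T ∧ #T = k} = k * Λ.choose k := by
  have h1 : ∀ a' : Fin Λ, #{T : Finset (Fin Λ) | a' ∈ T ∧ #T = k} =
      #{T : Finset (Fin Λ) | a ∈ T ∧ #T = k} := by
    intro a'
    refine card_equiv (Equiv.finsetCongr (Equiv.swap a a')) fun T => ?_
    simp only [mem_filter, mem_univ, true_and, Equiv.finsetCongr_apply, card_map, mem_map_equiv,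
      Equiv.symm_swap, Equiv.swap_apply_left]
  have h2 : ∑ a' : Fin Λ, #{T : Finset (Fin Λ) | a' ∈ T ∧ #T = k} = Λ.choose k * k := by
    have h3 : ∀ a' : Fin Λ, #{T : Finset (Fin Λ) | a' ∈ T ∧ #T = k} =
        ∑ T : Finset (Fin Λ) with #T = k, if a' ∈ T then 1 else 0 := by
      intro a'
      rw [← card_filter, filter_filter]
      exact congrArg card (filter_congr fun T _ => and_comm)
    rw [sum_congr rfl fun a' _ => h3 a', sum_comm, ← card_filter_card_eq, ← smul_eq_mul]
    refine sum_eq_card_nsmul fun T hT => ?_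
    rw [← card_filter, filter_univ_mem]
    exact (mem_filter.1 hT).2
  rw [sum_congr rfl fun a' _ => h1 a', sum_const, card_univ, Fintype.card_fin, smul_eq_mul] at h2
  rw [h2, mul_comm]

open Finset in
theorem card_stored {m x y z : ℕ} (e : Fin B ≃ labels Λ (mixture m x y z)) (a : Fin Λ) :
    #(stored N e a) = N * (x * #{T : Finset (Fin Λ) | a ∈ T ∧ #T = m + 1} +
      y * #{T : Finset (Fin Λ) | a ∈ T ∧ #T = m}) := by
  have h1 : stored N e a =
      (univ : Finset (Fin N)) ×ˢ ({b : Fin B | a ∈ (e b).1.1} : Finset (Fin B)) := by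
    ext p
    simp [stored]
  have h2 : #{b : Fin B | a ∈ (e b).1.1} =
      #((univ.filter fun T : Finset (Fin Λ) => a ∈ T).sigma fun T =>
        range (mixture m x y z #T)) := by
    refine card_bij (fun b _ => (e b).1) ?_ ?_ ?_
    · intro b hb
      have hT := mem_sigma.1
        (show (e b).1 ∈ univ.sigma fun T => range (mixture m x y z #T) from (e b).2)
      exact mem_sigma.2 ⟨mem_filter.2 ⟨mem_univ _, (mem_filter.1 hb).2⟩, hT.2⟩
    · exact fun b _ b' _ h => e.injective (Subtype.ext h)
    · intro i hi
      simp only [mem_sigma, mem_filter, mem_univ, true_and] at hi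
      have hi' : i ∈ labels Λ (mixture m x y z) := by
        simpa [labels] using hi.2
      exact ⟨e.symm ⟨i, hi'⟩, by simpa using hi.1, by simp⟩
  have h3 : #{T : Finset (Fin Λ) | a ∈ T ∧ #T = 0} = 0 := by
    rw [card_eq_zero, filter_eq_empty_iff]
    rintro T - ⟨h, h'⟩
    simp [card_eq_zero.1 h'] at h
  rw [h1, card_product, h2, card_sigma, card_univ, Fintype.card_fin]
  simp only [card_range, sum_mixture, filter_filter, h3, mul_zero, add_zero]

/-! ### Achievability -/

open Finset in
/-- Memory sharing between the schemes with replication `m` and `m + 1`, with the sizes of the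
subfiles rounded down, and the remaining bits not stored. The number of the latter is bounded
independently of the file size. -/
theorem exists_scheme_of_mixture {Ma Mp : ℝ} (hr : 1 ≤ r) (hrΛ : r ≤ Λ)
    (hMa : 0 ≤ Ma) (hMp : 0 ≤ Mp) (hM : Ma + Mp < N) (B : ℕ) :
    ∃ S : Scheme Λ r N B, S.Uses .xor ∧ S.placement.FitsMemory Ma Mp ∧
      ∀ d, (S.length d : ℝ) ≤ cmaccRate Λ r N (Ma + Mp / r) * B + 2 ^ (Λ + 2) * Λ.choose r := by
  have hr0 : (1 : ℝ) ≤ r := by exact_mod_cast hr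
  have hΛ : (0 : ℝ) < Λ := by exact_mod_cast hr.trans hrΛ
  have hN : (0 : ℝ) < N := by linarith
  have hN1 : (1 : ℝ) ≤ N := by exact_mod_cast (Nat.cast_pos.1 hN : 0 < N)
  set M : ℝ := Ma + Mp / r with hMdef
  have hM0 : 0 ≤ M := by positivity
  have hMN : M < N := by
    have : Mp / r ≤ Mp := div_le_self hMp hr0
    linarith
  set t : ℝ := Λ * M / N with ht
  have ht0 : 0 ≤ t := by positivity
  have htΛ : t < Λ := by
    rw [ht, div_lt_iff₀ hN]
    exact mul_lt_mul_of_pos_left hMN hΛ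
  have hrate : cmaccRate Λ r N M = memorySharing
      (fun t => (Λ.choose (t + r) : ℝ) / (Λ.choose t : ℝ)) t := rfl
  rw [hrate, memorySharing_eq _ ht0]
  set α := Int.fract t with hα
  have hα0 : 0 ≤ α := Int.fract_nonneg t
  have hα1 : 0 ≤ 1 - α := sub_nonneg.2 (Int.fract_lt_one t).le
  have hαt : α = t - ⌊t⌋₊ := fract_eq_sub_natFloor ht0
  set m := ⌊t⌋₊ with hm
  have hmΛ : m < Λ := (Nat.floor_lt ht0).2 htΛ
  set C₁ := Λ.choose (m + 1) with hC₁
  set C₀ := Λ.choose m with hC₀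
  have hC₁pos : (0 : ℝ) < C₁ := by exact_mod_cast Nat.choose_pos hmΛ
  have hC₀pos : (0 : ℝ) < C₀ := by exact_mod_cast Nat.choose_pos hmΛ.le
  -- Subfiles get one bit less than their exact share, so that every nonempty cache has the one bit
  -- of slack that splitting its content needs.
  set x := ⌊α * B / C₁ - 1⌋₊ with hx
  set y := ⌊(1 - α) * B / C₀ - 1⌋₊ with hy
  have floor_le : ∀ v : ℝ, 0 ≤ v → (⌊v - 1⌋₊ : ℝ) ≤ v ∧
      (⌊v - 1⌋₊ = 0 ∨ (⌊v - 1⌋₊ : ℝ) + 1 ≤ v) ∧ v ≤ ⌊v - 1⌋₊ + 2 := by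
    intro v hv
    have h2 := Nat.lt_floor_add_one (v - 1)
    rcases Nat.eq_zero_or_pos ⌊v - 1⌋₊ with h | h
    · have h0 : (⌊v - 1⌋₊ : ℝ) = 0 := by rw [h, Nat.cast_zero]
      exact ⟨h0.trans_le hv, Or.inl h, by linarith⟩
    · have h1 := Nat.floor_le (Nat.pos_of_floor_pos h).le
      exact ⟨by linarith, Or.inr (by linarith), by linarith⟩
  obtain ⟨hx1, hx2, hx3⟩ := floor_le (α * B / C₁) (by positivity)
  obtain ⟨hy1, hy2, hy3⟩ := floor_le ((1 - α) * B / C₀) (by positivity)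
  rw [← hx] at hx1 hx2 hx3
  rw [← hy] at hy1 hy2 hy3
  have hxC : (x : ℝ) * C₁ ≤ α * B := (le_div_iff₀ hC₁pos).1 hx1
  have hyC : (y : ℝ) * C₀ ≤ (1 - α) * B := (le_div_iff₀ hC₀pos).1 hy1
  have hxC' : α * B ≤ (x + 2) * C₁ := (div_le_iff₀ hC₁pos).1 hx3
  have hyC' : (1 - α) * B ≤ (y + 2) * C₀ := (div_le_iff₀ hC₀pos).1 hy3
  have hxy : x * C₁ + y * C₀ ≤ B := by
    have : (x : ℝ) * C₁ + y * C₀ ≤ B := by linarith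
    exact_mod_cast this
  obtain ⟨z, hz⟩ := Nat.exists_eq_add_of_le hxy
  have hzB : (z : ℝ) ≤ 2 * (C₁ + C₀) := by
    have : (B : ℝ) = x * C₁ + y * C₀ + z := by exact_mod_cast hz
    linarith
  have hz2 : (z : ℝ) ≤ 2 ^ (Λ + 2) := by
    have h1 : (C₁ : ℝ) ≤ 2 ^ Λ := by exact_mod_cast Nat.choose_le_two_pow Λ (m + 1)
    have h0 : (C₀ : ℝ) ≤ 2 ^ Λ := by exact_mod_cast Nat.choose_le_two_pow Λ m
    rw [pow_add]
    linarith
  have hcard : Fintype.card (Fin B) = Fintype.card (labels Λ (mixture m x y z)) := by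
    rw [Fintype.card_coe, card_labels, Fintype.card_fin, hz]
  let e : Fin B ≃ labels Λ (mixture m x y z) := Fintype.equivOfCardEq hcard
  obtain ⟨S, hS, hmem, hlen⟩ := exists_scheme_of_card_stored (N := N) e hr hMa hMp (by
    intro a
    rw [← hMdef, card_stored]
    set D₁ := #{T : Finset (Fin Λ) | a ∈ T ∧ #T = m + 1} with hD₁
    set D₀ := #{T : Finset (Fin Λ) | a ∈ T ∧ #T = m} with hD₀
    have hD₁C : (Λ : ℝ) * D₁ = (m + 1) * C₁ := by
      exact_mod_cast mul_card_filter_mem a (m + 1)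
    have hD₀C : (Λ : ℝ) * D₀ = m * C₀ := by exact_mod_cast mul_card_filter_mem a m
    have hD₁' : (D₁ : ℝ) = (m + 1) * C₁ / Λ := by rw [← hD₁C]; field_simp
    have hD₀' : (D₀ : ℝ) = m * C₀ / Λ := by rw [← hD₀C]; field_simp
    have hfull : N * (α * B / C₁ * D₁ + (1 - α) * B / C₀ * D₀) = M * B := by
      rw [hD₁', hD₀']
      have hMt : M = t * N / Λ := by rw [ht]; field_simp
      rw [hMt, hαt]
      field_simp
      ring
    have hD0 : (0 : ℝ) ≤ D₀ := Nat.cast_nonneg _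
    have hD1 : (0 : ℝ) ≤ D₁ := Nat.cast_nonneg _
    rw [← hfull]
    have hxD := mul_le_mul_of_nonneg_right hx1 hD1
    have hyD := mul_le_mul_of_nonneg_right hy1 hD0
    have hadd : ∀ u v : ℝ, u + 1 ≤ v → N * u + 1 ≤ N * v := by
      intro u v huv
      nlinarith
    by_cases hxD0 : x * D₁ = 0
    · by_cases hyD0 : y * D₀ = 0
      · left; rw [hxD0, hyD0, add_zero, mul_zero]
      · right
        obtain ⟨h1, h2⟩ := mul_ne_zero_iff.1 hyD0
        have h3 : (1 : ℝ) ≤ D₀ := by exact_mod_cast Nat.one_le_iff_ne_zero.2 h2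
        have h4 := mul_le_mul_of_nonneg_right (hy2.resolve_left h1) hD0
        push_cast
        exact hadd _ _ (by linarith)
    · right
      obtain ⟨h1, h2⟩ := mul_ne_zero_iff.1 hxD0
      have h3 : (1 : ℝ) ≤ D₁ := by exact_mod_cast Nat.one_le_iff_ne_zero.2 h2
      have h4 := mul_le_mul_of_nonneg_right (hx2.resolve_left h1) hD1
      push_cast
      exact hadd _ _ (by linarith))
  refine ⟨S, hS, hmem, fun d => ?_⟩
  rw [hlen, card_transmissions]
  push_cast
  have h1 := mul_le_mul_of_nonneg_right hx1 (Nat.cast_nonneg (α := ℝ) (Λ.choose (m + 1 + r)))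
  have h2 := mul_le_mul_of_nonneg_right hy1 (Nat.cast_nonneg (α := ℝ) (Λ.choose (m + r)))
  have h3 := mul_le_mul_of_nonneg_right hz2 (Nat.cast_nonneg (α := ℝ) (Λ.choose r))
  refine (add_le_add (add_le_add h1 h2) h3).trans (le_of_eq ?_)
  ring

/-- A rate above that of the multi-access scheme leaves room, for large files, for the bounded number
of extra bits that rounding costs. -/
theorem Achievable.of_cmaccRate_lt {Ma Mp R : ℝ} (hr : 1 ≤ r) (hrΛ : r ≤ Λ)
    (hMa : 0 ≤ Ma) (hMp : 0 ≤ Mp) (hM : Ma + Mp < N) (δ : Delivery)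
    (hR : cmaccRate Λ r N (Ma + Mp / r) < R) : Achievable δ Λ r N Ma Mp R := by
  have hlim : Filter.Tendsto (fun B : ℕ => (R - cmaccRate Λ r N (Ma + Mp / r)) * (B : ℝ))
      Filter.atTop Filter.atTop :=
    Filter.Tendsto.const_mul_atTop (sub_pos.2 hR) tendsto_natCast_atTop_atTop
  filter_upwards [hlim.eventually_ge_atTop (2 ^ (Λ + 2) * Λ.choose r : ℝ)] with B hB
  obtain ⟨S, hS, hmem, hlen⟩ := exists_scheme_of_mixture hr hrΛ hMa hMp hM B
  refine ⟨S, ?_, hmem, fun d => (hlen d).trans (by linarith)⟩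
  cases δ
  · trivial
  · exact hS

theorem manRate_le_of_achievable {Ma Mp R : ℝ} {δ : Delivery} (hrΛ : r ≤ Λ)
    (hN : Λ.choose r ≤ N) (hMa : 0 ≤ Ma) (hMp : 0 ≤ Mp) (h : Achievable δ Λ r N Ma Mp R) :
    manRate (Λ.choose r) N (r * Ma + Mp) ≤ R := by
  obtain ⟨B, ⟨S, -, hmem, hlen⟩, hB⟩ := (h.and (Filter.eventually_gt_atTop 0)).exists
  exact S.manRate_le hB hrΛ hN hMa hMp hmem hlen

end CMAP

theorem proposition1 (Λ r N : ℕ) (hr : 1 ≤ r) (hrΛ : r ≤ Λ) (hN : Λ.choose r ≤ N)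
    (Ma Mp : ℝ) (hMa : 0 ≤ Ma) (hMp : 0 ≤ Mp) (hM : Ma + Mp < N) (δ : CMAP.Delivery) :
    CMAP.manRate (Λ.choose r) N (r * Ma + Mp) ≤ CMAP.optimalRate δ Λ r N Ma Mp ∧
      CMAP.optimalRate δ Λ r N Ma Mp ≤ CMAP.cmaccRate Λ r N (Ma + Mp / r) := by
  have hlower : ∀ R ∈ {R : ℝ | CMAP.Achievable δ Λ r N Ma Mp R},
      CMAP.manRate (Λ.choose r) N (r * Ma + Mp) ≤ R := fun R hR =>
    CMAP.manRate_le_of_achievable hrΛ hN hMa hMp hR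
  refine ⟨le_csInf ⟨CMAP.cmaccRate Λ r N (Ma + Mp / r) + 1, ?_⟩ hlower, ?_⟩
  · exact CMAP.Achievable.of_cmaccRate_lt hr hrΛ hMa hMp hM δ (lt_add_one _)
  · exact le_of_forall_gt_imp_ge_of_dense fun R hR => csInf_le ⟨_, hlower⟩
      (CMAP.Achievable.of_cmaccRate_lt hr hrΛ hMa hMp hM δ hR)
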